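/- Let $N$ be a (Hausdorff) real-analytic manifold of dimension $n\ge 2$ equipped with a smooth Riemannian metric $h$ (not necessarily complete), and let $\mathcal F$ be a regular real-analytic foliation on $N$ of constant rank $d\in\{1,\dots,n-1\}$. Write $\mathcal L_x$ for the leaf of $\mathcal F$ through $x$ and, for $\ell>0$, $$\mathcal L_x^{\ell}=\{\,y\in\mathcal L_x : \text{there is an absolutely continuous } \varphi:[0,1]\to\mathcal L_x \text{ with } \varphi(0)=x,\ \varphi(1)=y,\ \mathrm{length}^h(\varphi)\le \ell\,\}$$ for the horizontal ball of radius $\ell$ at $x$. Let $\mathrm{vol}^{h,\mathcal F}$ denote the Riemannian volume on the leaves with respect to the metric induced by $h$. Two points $x,y\in N$ are called $(\mathcal F,\ell)$-related if there is a smooth path $\varphi:[0,1]\to N$ from $x$ to $y$, everywhere tangent to $\mathcal F$, whose length with respect to $h$ is at most $\ell$. A local transverse section at $\bar x\in N$ is a smooth embedded submanifold $S\subset N$ containing $\bar x$, diffeomorphic to an open disc of dimension $n-d$ and transverse to the leaves of $\mathcal F$. Assume that the horizontal balls have locally bounded volume: for every $x\in N$ and every $\ell>0$ there are $V>0$ and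 a neighborhood $\mathcal U$ of $x$ such that $\mathrm{vol}^{h,\mathcal F}(\mathcal L_y^{\ell})\le V$ for all $y\in\mathcal U$. Then $\mathcal F$ is splittable in $(N,h)$: for every $\bar x\in N$, every local transverse section $S$ at $\bar x$, every $\ell>0$ and every Lebesgue measurable set $E\subset S$ of positive $(n-d)$-dimensional Lebesgue measure in $S$, there is a Lebesgue measurable set $F\subset E$ of positive $(n-d)$-dimensional Lebesgue measure in $S$ such that no two distinct points of $F$ are $(\mathcal F,\ell)$-related. -/

import Mathlib

open Set Filter Topology MeasureTheory Metric Bundle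
open scoped Manifold ContDiff ENNReal

noncomputable section

/-- A (regular) real-analytic foliation of rank `d` on an `n`-dimensional manifold `N`, given by an
atlas of foliation charts: analytic diffeomorphisms from open sets of `N` onto products of open
discs `V₁ × V₂ ⊆ ℝ^d × ℝ^(n-d)`, whose domains cover `N` and whose changes of coordinates have
(locally) the form `(x, y) ↦ (h₁ (x, y), h₂ y)`. -/
structure AnalyticFoliation (n d : ℕ) (N : Type*) [TopologicalSpace N]
    [ChartedSpace (EuclideanSpace ℝ (Fin n)) N] where
  charts : Set (OpenPartialHomeomorph N
    (EuclideanSpace ℝ (Fin d) × EuclideanSpace ℝ (Fin (n - d))))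
  analytic : ∀ e ∈ charts, ContMDiffOn (𝓡 n)
    𝓘(ℝ, EuclideanSpace ℝ (Fin d) × EuclideanSpace ℝ (Fin (n - d))) ω e e.source
  analytic_symm : ∀ e ∈ charts, ContMDiffOn
    𝓘(ℝ, EuclideanSpace ℝ (Fin d) × EuclideanSpace ℝ (Fin (n - d))) (𝓡 n) ω e.symm e.target
  target_eq : ∀ e ∈ charts, ∃ (a : EuclideanSpace ℝ (Fin d)) (b : EuclideanSpace ℝ (Fin (n - d)))
    (r s : ℝ), 0 < r ∧ 0 < s ∧ e.target = ball a r ×ˢ ball b s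
  cover : ∀ x : N, ∃ e ∈ charts, x ∈ e.source
  compatible : ∀ e ∈ charts, ∀ e' ∈ charts, ∀ p ∈ e.target, e.symm p ∈ e'.source →
    ∃ h₂ : EuclideanSpace ℝ (Fin (n - d)) → EuclideanSpace ℝ (Fin (n - d)),
      ∀ᶠ p' in 𝓝 p, (e' (e.symm p')).2 = h₂ p'.2

namespace AnalyticFoliation

variable {n d : ℕ} {N : Type*} [TopologicalSpace N] [ChartedSpace (EuclideanSpace ℝ (Fin n)) N]

/-- Two points lie on a common plaque `{y = const}` of some foliation chart. -/
def SamePlaque (F : AnalyticFoliation n d N) (z z' : N) : Prop :=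
  ∃ e ∈ F.charts, z ∈ e.source ∧ z' ∈ e.source ∧ (e z).2 = (e z').2

/-- The leaf through `x`: all points that can be reached from `x` by a finite chain of plaques. -/
def leaf (F : AnalyticFoliation n d N) (x : N) : Set N :=
  {y | Relation.ReflTransGen F.SamePlaque x y}

/-- The tangent space at `x` of the leaf through `x`: the vectors without transverse component in
the foliation charts around `x`. By compatibility, all these charts give the same subspace. -/
def tangent (F : AnalyticFoliation n d N) (x : N) : Submodule ℝ (TangentSpace (𝓡 n) x) where
  carrier := {v | ∀ e ∈ F.charts, x ∈ e.source →
    Prod.snd (α := EuclideanSpace ℝ (Fin d)) (β := EuclideanSpace ℝ (Fin (n - d)))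
      (mfderiv (𝓡 n) 𝓘(ℝ, EuclideanSpace ℝ (Fin d) × EuclideanSpace ℝ (Fin (n - d))) e x v) = 0}
  zero_mem' := by
    intro e _ _
    rw [map_zero]
    rfl
  add_mem' := by
    intro v w hv hw e he hx
    rw [map_add]
    exact (congrArg₂ (· + ·) (hv e he hx) (hw e he hx)).trans (add_zero _)
  smul_mem' := by
    intro c v hv e he hx
    rw [map_smul]
    exact (congrArg (c • ·) (hv e he hx)).trans (smul_zero c)

/-- A smooth path `[0,1] → N` which is horizontal, i.e. everywhere tangent to the foliation. -/
def IsSmoothHorizontalPath (F : AnalyticFoliation n d N) (φ : ℝ → N) : Prop :=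
  ContMDiffOn 𝓘(ℝ, ℝ) (𝓡 n) ∞ φ (Icc 0 1) ∧
    ∀ t ∈ Icc (0 : ℝ) 1, mfderivWithin 𝓘(ℝ, ℝ) (𝓡 n) φ (Icc 0 1) t (1 : ℝ) ∈ F.tangent (φ t)

/-- An absolutely continuous curve `[0,1] → N` inside a leaf, the leaf being the immersed
submanifold whose charts are the plaque coordinates `z ↦ (e z).1`: locally the curve stays in one
plaque, and its plaque coordinate is absolutely continuous. -/
def IsLeafwiseACPath (F : AnalyticFoliation n d N) (φ : ℝ → N) : Prop :=
  ∀ t ∈ Icc (0 : ℝ) 1, ∃ e ∈ F.charts, ∃ δ > 0,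
    (∀ s ∈ Icc (max 0 (t - δ)) (min 1 (t + δ)), φ s ∈ e.source ∧ (e (φ s)).2 = (e (φ t)).2) ∧
    AbsolutelyContinuousOnInterval (fun s => (e (φ s)).1) (max 0 (t - δ)) (min 1 (t + δ))

/-- A Borel subset of a plaque: the points with coordinates `(u, height)`, `u ∈ params`, in a
foliation chart. -/
structure PlaquePiece (F : AnalyticFoliation n d N) where
  chart : OpenPartialHomeomorph N (EuclideanSpace ℝ (Fin d) × EuclideanSpace ℝ (Fin (n - d)))
  chart_mem : chart ∈ F.charts
  height : EuclideanSpace ℝ (Fin (n - d))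
  params : Set (EuclideanSpace ℝ (Fin d))
  measurableSet_params : MeasurableSet params
  mem_target : ∀ u ∈ params, (u, height) ∈ chart.target

/-- The parametrization `u ↦ e⁻¹ (u, y)` of the plaque that contains the piece. -/
def PlaquePiece.plaqueMap {F : AnalyticFoliation n d N} (P : F.PlaquePiece) :
    EuclideanSpace ℝ (Fin d) → N :=
  fun u => P.chart.symm (u, P.height)

def PlaquePiece.carrier {F : AnalyticFoliation n d N} (P : F.PlaquePiece) : Set N :=
  P.plaqueMap '' P.params

/-- A local transverse section at `xbar`: a smooth embedded submanifold of `N` containing `xbar`,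
diffeomorphic to the open unit disc of dimension `n - d` (through `param`), and transverse to the
leaves. -/
structure LocalTransverseSection (F : AnalyticFoliation n d N) (xbar : N) where
  param : EuclideanSpace ℝ (Fin (n - d)) → N
  contMDiffOn : ContMDiffOn (𝓡 (n - d)) (𝓡 n) ∞ param (ball 0 1)
  isEmbedding : IsEmbedding fun u : ball (0 : EuclideanSpace ℝ (Fin (n - d))) 1 => param u
  injective_mfderiv : ∀ u ∈ ball (0 : EuclideanSpace ℝ (Fin (n - d))) 1,
    Function.Injective (mfderiv (𝓡 (n - d)) (𝓡 n) param u)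
  transverse : ∀ u ∈ ball (0 : EuclideanSpace ℝ (Fin (n - d))) 1,
    F.tangent (param u) ⊔
      LinearMap.range (mfderiv (𝓡 (n - d)) (𝓡 n) param u :
        TangentSpace (𝓡 (n - d)) u →ₗ[ℝ] TangentSpace (𝓡 n) (param u)) = ⊤
  mem : xbar ∈ param '' ball 0 1

namespace LocalTransverseSection

variable {F : AnalyticFoliation n d N} {xbar : N}

def carrier (S : F.LocalTransverseSection xbar) : Set N := S.param '' ball 0 1

/-- A subset of the section, read in the disc. -/
def inDisc (S : F.LocalTransverseSection xbar) (E : Set N) :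
    Set (EuclideanSpace ℝ (Fin (n - d))) := ball 0 1 ∩ S.param ⁻¹' E

/-- `E` is a Lebesgue measurable subset of the submanifold `S`. (Lebesgue measurable sets and
Lebesgue null sets of a submanifold do not depend on the parametrization.) -/
def IsLebesgueMeasurable (S : F.LocalTransverseSection xbar) (E : Set N) : Prop :=
  E ⊆ S.carrier ∧ NullMeasurableSet (S.inDisc E) volume

/-- `E` has positive Lebesgue measure in `S`. -/
def HasPositiveMeasure (S : F.LocalTransverseSection xbar) (E : Set N) : Prop :=
  0 < volume (S.inDisc E)

end LocalTransverseSection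

variable [RiemannianBundle (fun x : N => TangentSpace (𝓡 n) x)]

/-- `x` and `y` are `(F, ℓ)`-related: a smooth horizontal path of length at most `ℓ` joins them. -/
def Related (F : AnalyticFoliation n d N) (l : ℝ) (x y : N) : Prop :=
  ∃ φ : ℝ → N, F.IsSmoothHorizontalPath φ ∧ φ 0 = x ∧ φ 1 = y ∧
    Manifold.pathELength (𝓡 n) φ 0 1 ≤ ENNReal.ofReal l

/-- The horizontal ball of radius `ℓ` at `x`: the points of the leaf of `x` that an absolutely
continuous curve inside this leaf, of length at most `ℓ`, joins to `x`. -/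
def horizontalBall (F : AnalyticFoliation n d N) (x : N) (l : ℝ) : Set N :=
  {y | y ∈ F.leaf x ∧ ∃ φ : ℝ → N, F.IsLeafwiseACPath φ ∧
    (∀ t ∈ Icc (0 : ℝ) 1, φ t ∈ F.leaf x) ∧ φ 0 = x ∧ φ 1 = y ∧
    Manifold.pathELength (𝓡 n) φ 0 1 ≤ ENNReal.ofReal l}

/-- The `i`-th coordinate vector field of the plaque, at the point with coordinate `u`. -/
def PlaquePiece.coordVec {F : AnalyticFoliation n d N} (P : F.PlaquePiece)
    (u : EuclideanSpace ℝ (Fin d)) (i : Fin d) : TangentSpace (𝓡 n) (P.plaqueMap u) :=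
  mfderiv (𝓡 d) (𝓡 n) P.plaqueMap u (EuclideanSpace.single i (1 : ℝ))

/-- The Riemannian volume of a piece of a plaque for the metric induced on the plaque:
`∫ √det (g_ij) du` with `g_ij = ⟨∂_i, ∂_j⟩`. -/
def PlaquePiece.riemannianVolume {F : AnalyticFoliation n d N} (P : F.PlaquePiece) : ℝ≥0∞ :=
  ∫⁻ u in P.params, ENNReal.ofReal (Real.sqrt (Matrix.det (Matrix.of fun i j : Fin d =>
    (inner ℝ (P.coordVec u i) (P.coordVec u j) : ℝ))))

/-- The Riemannian volume, for the metric induced on the leaves, of a set `A` contained in a leaf: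
the supremum of the total volumes of finite families of pairwise disjoint Borel pieces of plaques
inside `A`. A leaf is covered by countably many plaques, and the volume of a piece does not depend
on the chart in which it is computed, so for Borel `A` this is the usual Riemannian measure. -/
def leafVolume (F : AnalyticFoliation n d N) (A : Set N) : ℝ≥0∞ :=
  ⨆ (k : ℕ) (P : Fin k → F.PlaquePiece)
    (_ : Pairwise fun i j => Disjoint (P i).carrier (P j).carrier)
    (_ : ∀ i, (P i).carrier ⊆ A), ∑ i, (P i).riemannianVolume

/-- The foliation has locally horizontal balls with finite volume. -/
def HasLocallyFiniteVolumeBalls (F : AnalyticFoliation n d N) : Prop :=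
  ∀ x : N, ∀ l > (0 : ℝ), ∃ V > (0 : ℝ), ∃ U ∈ 𝓝 x, ∀ y ∈ U,
    F.leafVolume (F.horizontalBall y l) ≤ ENNReal.ofReal V

/-- The foliation is splittable. -/
def IsSplittable (F : AnalyticFoliation n d N) : Prop :=
  ∀ (xbar : N) (S : F.LocalTransverseSection xbar), ∀ l > (0 : ℝ), ∀ E : Set N,
    S.IsLebesgueMeasurable E → S.HasPositiveMeasure E →
    ∃ G ⊆ E, S.IsLebesgueMeasurable G ∧ S.HasPositiveMeasure G ∧
      ∀ x ∈ G, ∀ y ∈ G, x ≠ y → ¬ F.Related l x y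

end AnalyticFoliation

end

/-! Points of a section `S` that return to `S` along short leaf curves are controlled by volume. If
infinitely many points of `S` near `a` were joined to `a` by leafwise curves of bounded length, each
would carry a small plaque disc of volume bounded below. The heights of these points are distinct,
since height in a foliation chart is a local coordinate on `S`, so the discs are disjoint; all lie
in one horizontal ball at `a`, whose volume is finite. Hence each `a` has a positive return distance
(`eventually_not_plaqueChain`), and `E` is the union over `k` of the sets of points that do not
return within distance `1/(k+1)`. One of these has positive measure, and a piece of it of small
diameter is the required set.

Measurability is the delicate point. It is obtained by replacing smooth paths with plaque chains:
finite sequences of coordinate segments whose speeds satisfy strict bounds. Such chains persist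
under holonomy, so the set of returning points is open (`isOpen_returnSet`). A path of length `l`
yields a chain of cost at most `4 * l + ε` (`Related.plaqueChain`), and a chain of cost `c` yields a
leafwise path of length at most `c` (`PlaqueChain.leafJoined`), which ties chains to horizontal
balls. -/

noncomputable section

namespace AnalyticFoliation

variable {n d : ℕ} {N : Type*} [TopologicalSpace N] [ChartedSpace (EuclideanSpace ℝ (Fin n)) N]

/-! ### Riemannian norm of plaque directions in a foliation chart -/

section

/-- The model space of a foliation chart: plaque coordinates times transverse coordinates. -/
abbrev PlaqueModel (n d : ℕ) : Type :=
  EuclideanSpace ℝ (Fin d) × EuclideanSpace ℝ (Fin (n - d))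

/-- The image of a plaque direction `v` under the inverse of a foliation chart. -/
def plaqueVec (e : OpenPartialHomeomorph N (PlaqueModel n d))
    (q : PlaqueModel n d)
    (v : EuclideanSpace ℝ (Fin d)) : TangentSpace (𝓡 n) (e.symm q) :=
  mfderiv 𝓘(ℝ, PlaqueModel n d) (𝓡 n) e.symm q
    ((v, 0) : PlaqueModel n d)

theorem plaqueVec_smul (e : OpenPartialHomeomorph N (PlaqueModel n d))
    (q : PlaqueModel n d) (c : ℝ)
    (v : EuclideanSpace ℝ (Fin d)) : plaqueVec e q (c • v) = c • plaqueVec e q v := by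
  have h0 : ((c • v, 0) : PlaqueModel n d) = c • (v, 0) := by simp
  have h := (mfderiv 𝓘(ℝ, PlaqueModel n d) (𝓡 n) e.symm q).map_smul c ((v, 0) : PlaqueModel n d)
  refine Eq.trans ?_ h
  exact congrArg (mfderiv 𝓘(ℝ, PlaqueModel n d) (𝓡 n) e.symm q) h0

/-- The tangent map of `e.symm` is continuous between tangent bundles. Continuity is stated in the
total space because the norm varies with the fibre. -/
theorem continuousOn_plaqueVec [IsManifold (𝓡 n) ω N] (F : AnalyticFoliation n d N)
    {e : OpenPartialHomeomorph N (PlaqueModel n d)}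
    (he : e ∈ F.charts) :
    ContinuousOn (fun p : PlaqueModel n d ×
        EuclideanSpace ℝ (Fin d) => (⟨e.symm p.1, plaqueVec e p.1 p.2⟩ : TangentBundle (𝓡 n) N))
      (e.target ×ˢ univ) := by
  have : IsManifold (𝓡 n) 1 N := IsManifold.of_le (n := ω) (by simp)
  have h := (F.analytic_symm e he).continuousOn_tangentMapWithin (by simp)
    e.open_target.uniqueMDiffOn
  have h2 : Continuous (fun p : PlaqueModel n d ×
        EuclideanSpace ℝ (Fin d) => (⟨p.1, (p.2, 0)⟩ :
          TangentBundle 𝓘(ℝ, PlaqueModel n d) (PlaqueModel n d))) := by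
    exact (tangentBundleModelSpaceHomeomorph 𝓘(ℝ, PlaqueModel n d)).symm.continuous.comp
      (f := fun p : PlaqueModel n d ×
        EuclideanSpace ℝ (Fin d) => (p.1, (p.2, 0))) (by fun_prop)
  refine (h.comp h2.continuousOn (fun p hp => hp.1)).congr ?_
  intro p hp
  simp only [Function.comp, tangentMapWithin, plaqueVec]
  rw [mfderivWithin_of_isOpen e.open_target hp.1]

theorem mdifferentiableAt_chart (F : AnalyticFoliation n d N)
    {e : OpenPartialHomeomorph N (PlaqueModel n d)}
    (he : e ∈ F.charts) {x : N} (hx : x ∈ e.source) :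
    MDifferentiableAt (𝓡 n) 𝓘(ℝ, PlaqueModel n d) e x :=
  ((F.analytic e he).contMDiffAt (e.open_source.mem_nhds hx)).mdifferentiableAt (by simp)

theorem mdifferentiableAt_chart_symm (F : AnalyticFoliation n d N)
    {e : OpenPartialHomeomorph N (PlaqueModel n d)}
    (he : e ∈ F.charts) {q : PlaqueModel n d}
    (hq : q ∈ e.target) :
    MDifferentiableAt 𝓘(ℝ, PlaqueModel n d) (𝓡 n) e.symm q :=
  ((F.analytic_symm e he).contMDiffAt (e.open_target.mem_nhds hq)).mdifferentiableAt (by simp)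

theorem mfderiv_chart_symm_apply (F : AnalyticFoliation n d N)
    {e : OpenPartialHomeomorph N (PlaqueModel n d)}
    (he : e ∈ F.charts) {q : PlaqueModel n d}
    (hq : q ∈ e.target)
    (w : PlaqueModel n d) :
    mfderiv (𝓡 n) 𝓘(ℝ, PlaqueModel n d) e (e.symm q)
      (mfderiv 𝓘(ℝ, PlaqueModel n d) (𝓡 n) e.symm q w) = w := by
  have h := mfderiv_comp q (F.mdifferentiableAt_chart he (e.map_target hq))
    (F.mdifferentiableAt_chart_symm he hq)
  have h2 : e ∘ e.symm =ᶠ[𝓝 q] id := by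
    filter_upwards [e.open_target.mem_nhds hq] with p hp using e.right_inv hp
  rw [h2.mfderiv_eq, mfderiv_id] at h
  exact (DFunLike.congr_fun h w).symm

theorem mfderiv_symm_chart_apply (F : AnalyticFoliation n d N)
    {e : OpenPartialHomeomorph N (PlaqueModel n d)}
    (he : e ∈ F.charts) {x : N} (hx : x ∈ e.source) (w : EuclideanSpace ℝ (Fin n)) :
    (mfderiv 𝓘(ℝ, PlaqueModel n d) (𝓡 n) e.symm (e x)
     (mfderiv (𝓡 n) 𝓘(ℝ, PlaqueModel n d) e x w)) = w := by
  have h := mfderiv_comp x (F.mdifferentiableAt_chart_symm he (e.map_source hx))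
    (F.mdifferentiableAt_chart he hx)
  have h2 : e.symm ∘ e =ᶠ[𝓝 x] id := by
    filter_upwards [e.open_source.mem_nhds hx] with p hp using e.left_inv hp
  rw [h2.mfderiv_eq, mfderiv_id] at h
  exact (DFunLike.congr_fun h w).symm

theorem plaqueVec_eq_zero (F : AnalyticFoliation n d N)
    {e : OpenPartialHomeomorph N (PlaqueModel n d)}
    (he : e ∈ F.charts) {q : PlaqueModel n d}
    (hq : q ∈ e.target) {v : EuclideanSpace ℝ (Fin d)} (hv : plaqueVec e q v = 0) : v = 0 := by
  have h := F.mfderiv_chart_symm_apply he hq (v, 0)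
  unfold plaqueVec at hv
  rw [hv, map_zero] at h
  exact (congrArg Prod.fst h).symm

variable [RiemannianBundle (fun x : N => TangentSpace (𝓡 n) x)]

/-- The Riemannian norm of a plaque direction. -/
def plaqueSpeed (e : OpenPartialHomeomorph N (PlaqueModel n d))
    (q : PlaqueModel n d)
    (v : EuclideanSpace ℝ (Fin d)) : ℝ := ‖plaqueVec e q v‖

theorem plaqueSpeed_smul (e : OpenPartialHomeomorph N (PlaqueModel n d)) (q : PlaqueModel n d)
    {c : ℝ} (hc : 0 ≤ c) (v : EuclideanSpace ℝ (Fin d)) :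
    plaqueSpeed e q (c • v) = c * plaqueSpeed e q v := by
  unfold plaqueSpeed
  rw [plaqueVec_smul, norm_smul, Real.norm_of_nonneg hc]

theorem isContinuousRiemannianBundle_tangent [IsManifold (𝓡 n) ω N]
    [h : IsContMDiffRiemannianBundle (𝓡 n) ∞ (EuclideanSpace ℝ (Fin n))
      (fun x : N => TangentSpace (𝓡 n) x)] :
    IsContinuousRiemannianBundle (EuclideanSpace ℝ (Fin n))
      (fun x : N => TangentSpace (𝓡 n) x) := by
  obtain ⟨g, hg, hi⟩ := h.exists_contMDiff
  exact ⟨g, hg.continuous, hi⟩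

variable [IsManifold (𝓡 n) ω N] [IsContMDiffRiemannianBundle (𝓡 n) ∞ (EuclideanSpace ℝ (Fin n))
      (fun x : N => TangentSpace (𝓡 n) x)] (F : AnalyticFoliation n d N)
    {e : OpenPartialHomeomorph N (PlaqueModel n d)}

theorem continuousOn_inner_plaqueVec (he : e ∈ F.charts) (v w : EuclideanSpace ℝ (Fin d)) :
    ContinuousOn (fun q => (inner ℝ (plaqueVec e q v) (plaqueVec e q w) : ℝ)) e.target := by
  have h (v : EuclideanSpace ℝ (Fin d)) : ContinuousOn
      (fun q => (⟨e.symm q, plaqueVec e q v⟩ : TangentBundle (𝓡 n) N)) e.target :=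
    (F.continuousOn_plaqueVec he).comp (f := fun q => (q, v)) (by fun_prop)
      (fun q hq => ⟨hq, mem_univ _⟩)
  have := isContinuousRiemannianBundle_tangent (n := n) (N := N)
  exact (h v).inner_bundle (h w)

theorem continuousAt_plaqueSpeed (he : e ∈ F.charts)
    {q : PlaqueModel n d}
    (hq : q ∈ e.target) (v : EuclideanSpace ℝ (Fin d)) :
    ContinuousAt (fun p : PlaqueModel n d ×
        EuclideanSpace ℝ (Fin d) => plaqueSpeed e p.1 p.2) (q, v) := by
  have h := (F.continuousOn_plaqueVec he).continuousAt
    ((e.open_target.prod isOpen_univ).mem_nhds (⟨hq, mem_univ v⟩ : (q, v) ∈ e.target ×ˢ univ))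
  have := isContinuousRiemannianBundle_tangent (n := n) (N := N)
  have h2 := (h.inner_bundle h).sqrt
  refine h2.congr (Eventually.of_forall fun p => ?_)
  exact (norm_eq_sqrt_real_inner _).symm

/-- On the unit sphere the speed at `q₀` is positive, so the strict inequalities persist near `q₀`,
uniformly by compactness; homogeneity gives all `v`. Near `q₀` the metric may thus be frozen at the
price of a factor 2. -/
theorem eventually_plaqueSpeed_le (he : e ∈ F.charts)
    {q₀ : PlaqueModel n d} (hq : q₀ ∈ e.target) :
    ∀ᶠ q in 𝓝 q₀, ∀ v, plaqueSpeed e q v ≤ 2 * plaqueSpeed e q₀ v ∧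
      plaqueSpeed e q₀ v ≤ 2 * plaqueSpeed e q v := by
  have h : ∀ᶠ q in 𝓝 q₀, ∀ v ∈ sphere (0 : EuclideanSpace ℝ (Fin d)) 1,
      plaqueSpeed e q v < 2 * plaqueSpeed e q₀ v ∧
      plaqueSpeed e q₀ v < 2 * plaqueSpeed e q v := by
    refine (isCompact_sphere _ _).eventually_forall_of_forall_eventually fun v hv => ?_
    have hpos : 0 < plaqueSpeed e q₀ v := by
      refine norm_pos_iff.2 fun h => ?_
      have := F.plaqueVec_eq_zero he hq h
      simp [this] at hv
    have h1 := F.continuousAt_plaqueSpeed he hq v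
    have h2 : ContinuousAt (fun p : PlaqueModel n d ×
        EuclideanSpace ℝ (Fin d) => plaqueSpeed e q₀ p.2) (q₀, v) :=
      ContinuousAt.comp (f := fun p : PlaqueModel n d ×
        EuclideanSpace ℝ (Fin d) => (q₀, p.2)) (x := (q₀, v)) h1 (by fun_prop)
    exact (h1.eventually_lt (h2.const_mul 2) (by simp; linarith)).and
      (h2.eventually_lt (h1.const_mul 2) (by simp; linarith))
  filter_upwards [h] with q hq v
  rcases eq_or_ne v 0 with rfl | hv
  · have h0 (q) : plaqueSpeed e q 0 = 0 := by
      simpa using plaqueSpeed_smul e q le_rfl (0 : EuclideanSpace ℝ (Fin d))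
    simp [h0]
  · have hn : 0 < ‖v‖ := norm_pos_iff.2 hv
    obtain ⟨h1, h2⟩ := hq (‖v‖⁻¹ • v) (by simp [norm_smul, hn.ne'])
    rw [plaqueSpeed_smul _ _ (by positivity), plaqueSpeed_smul _ _ (by positivity)] at h1 h2
    have hi : 0 < ‖v‖⁻¹ := by positivity
    constructor
    · refine le_of_mul_le_mul_left (a := ‖v‖⁻¹) ?_ hi
      linarith
    · refine le_of_mul_le_mul_left (a := ‖v‖⁻¹) ?_ hi
      linarith

end

/-! ### Plaque chains and their transport by holonomy -/

section

theorem lineMap_mem_target (F : AnalyticFoliation n d N)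
    {e : OpenPartialHomeomorph N (PlaqueModel n d)} (he : e ∈ F.charts) {p q : PlaqueModel n d}
    (hp : p ∈ e.target) (hq : q ∈ e.target) {s : ℝ} (hs : s ∈ Icc (0 : ℝ) 1) :
    AffineMap.lineMap p q s ∈ e.target := by
  obtain ⟨a, b, r, s', _, _, h⟩ := F.target_eq e he
  have hc : Convex ℝ e.target := by
    rw [h]
    exact (convex_ball a r).prod (convex_ball b s')
  exact hc.lineMap_mem hp hq hs

variable [RiemannianBundle (fun x : N => TangentSpace (𝓡 n) x)]

/-- Along the coordinate segment from `z` to `w`, the plaque component of its direction has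
Riemannian norm less than `c`. -/
def SegmentSpeedLT (e : OpenPartialHomeomorph N (PlaqueModel n d)) (z w : N) (c : ℝ≥0∞) : Prop :=
  z ∈ e.source ∧ w ∈ e.source ∧ ∀ s ∈ Icc (0 : ℝ) 1,
    ENNReal.ofReal (plaqueSpeed e (AffineMap.lineMap (e z) (e w) s) ((e w).1 - (e z).1)) < c

/-- `w` is reached from `z` along a coordinate segment in a plaque, of length less than `c`. -/
def PlaqueStep (F : AnalyticFoliation n d N) (z w : N) (c : ℝ≥0∞) : Prop :=
  ∃ e ∈ F.charts, (e z).2 = (e w).2 ∧ SegmentSpeedLT e z w c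

/-- `w` is reached from `z` by finitely many plaque steps of total cost `c`. -/
inductive PlaqueChain (F : AnalyticFoliation n d N) (z : N) : N → ℝ≥0∞ → Prop
  | refl : PlaqueChain F z z 0
  | step {w v : N} {c c' : ℝ≥0∞} : PlaqueChain F z w c → F.PlaqueStep w v c' →
      PlaqueChain F z v (c + c')

theorem segmentSpeedLT_self {e : OpenPartialHomeomorph N (PlaqueModel n d)} {z : N}
    (hz : z ∈ e.source) {c : ℝ≥0∞} (hc : 0 < c) : SegmentSpeedLT e z z c := by
  refine ⟨hz, hz, fun s _ => ?_⟩
  have h := plaqueSpeed_smul e (AffineMap.lineMap (e z) (e z) s) le_rfl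
    (0 : EuclideanSpace ℝ (Fin d))
  rw [zero_smul, zero_mul] at h
  rw [sub_self, h]
  simpa using hc

variable [IsManifold (𝓡 n) ω N] [IsContMDiffRiemannianBundle (𝓡 n) ∞ (EuclideanSpace ℝ (Fin n))
      (fun x : N => TangentSpace (𝓡 n) x)] (F : AnalyticFoliation n d N)
    {e : OpenPartialHomeomorph N (PlaqueModel n d)}

/-- A strict bound over the compact range of `s` is stable under perturbation. The endpoints may
move independently, since `SegmentSpeedLT` does not ask for equal heights. -/
theorem eventually_segmentSpeedLT (he : e ∈ F.charts) {z w : N} {c : ℝ≥0∞}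
    (h : SegmentSpeedLT e z w c) : ∀ᶠ p in 𝓝 (z, w), SegmentSpeedLT e p.1 p.2 c := by
  obtain ⟨hz, hw, hs⟩ := h
  have h1 : ∀ᶠ p in 𝓝 (z, w), ∀ s ∈ Icc (0 : ℝ) 1,
      ENNReal.ofReal (plaqueSpeed e (AffineMap.lineMap (e p.1) (e p.2) s)
        ((e p.2).1 - (e p.1).1)) < c := by
    refine isCompact_Icc.eventually_forall_of_forall_eventually fun s hs' => ?_
    have hez : ContinuousAt (fun p : (N × N) × ℝ => e p.1.1) ((z, w), s) :=
      ContinuousAt.comp (f := fun p : (N × N) × ℝ => p.1.1) (g := e) (e.continuousAt hz)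
        (by fun_prop)
    have hew : ContinuousAt (fun p : (N × N) × ℝ => e p.1.2) ((z, w), s) :=
      ContinuousAt.comp (f := fun p : (N × N) × ℝ => p.1.2) (g := e) (e.continuousAt hw)
        (by fun_prop)
    have hq := F.lineMap_mem_target he (e.map_source hz) (e.map_source hw) hs'
    have hl : ContinuousAt (fun p : (N × N) × ℝ =>
        ((AffineMap.lineMap (e p.1.1) (e p.1.2) p.2 : PlaqueModel n d),
          (e p.1.2).1 - (e p.1.1).1)) ((z, w), s) := by
      simp only [AffineMap.lineMap_apply_module]
      exact (((continuousAt_const.sub continuousAt_snd).smul hez).add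
        (continuousAt_snd.smul hew)).prodMk (hew.fst.sub hez.fst)
    have := ContinuousAt.comp (f := fun p : (N × N) × ℝ =>
        ((AffineMap.lineMap (e p.1.1) (e p.1.2) p.2 : PlaqueModel n d),
          (e p.1.2).1 - (e p.1.1).1)) (x := ((z, w), s))
          (F.continuousAt_plaqueSpeed he hq ((e w).1 - (e z).1)) hl
    exact (ENNReal.continuous_ofReal.continuousAt.comp this).eventually_lt continuousAt_const
      (hs s hs')
  filter_upwards [h1, (e.open_source.prod e.open_source).mem_nhds (mk_mem_prod hz hw)]
    with p hp hp2 using ⟨hp2.1, hp2.2, hp⟩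

/-- Plaque chains can be transported along the holonomy to nearby leaves. -/
theorem PlaqueChain.eventually_exists {F : AnalyticFoliation n d N} {z w : N} {c : ℝ≥0∞}
    (h : F.PlaqueChain z w c) {W : Set N} (hW : W ∈ 𝓝 w) :
    ∀ᶠ z' in 𝓝 z, ∃ w' ∈ W, F.PlaqueChain z' w' c := by
  induction h generalizing W with
  | refl =>
    filter_upwards [hW] with z' hz' using ⟨z', hz', .refl⟩
  | @step w v c c' _ hs ih =>
    obtain ⟨e, he, hh, hs⟩ := hs
    have hw := hs.1
    have hv := hs.2.1
    -- Holonomy of the last step: keep the plaque coordinate of `v` and take the height of the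
    -- perturbed point `w'`.
    have hg : ContinuousAt (fun w' => e.symm ((e v).1, (e w').2)) w := by
      refine ContinuousAt.comp (g := e.symm) ?_
        (continuousAt_const.prodMk (e.continuousAt hw).snd)
      rw [hh]
      exact e.continuousAt_symm (e.map_source hv)
    have hgw : e.symm ((e v).1, (e w).2) = v := by
      rw [hh]
      exact e.left_inv hv
    have ht : ∀ᶠ w' in 𝓝 w, ((e v).1, (e w').2) ∈ e.target := by
      refine (continuousAt_const.prodMk (e.continuousAt hw).snd).eventually_mem ?_
      rw [hh]
      exact e.open_target.mem_nhds (e.map_source hv)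
    have h1 : ∀ᶠ w' in 𝓝 w, SegmentSpeedLT e w' (e.symm ((e v).1, (e w').2)) c' := by
      have := continuousAt_id.prodMk hg
      refine this.eventually (p := fun p : N × N => SegmentSpeedLT e p.1 p.2 c') ?_
      simp only [id, hgw]
      exact F.eventually_segmentSpeedLT he hs
    have h2 : ∀ᶠ w' in 𝓝 w, e.symm ((e v).1, (e w').2) ∈ W :=
      hg.eventually_mem (by rwa [hgw])
    filter_upwards [ih (h1.and (h2.and ht))] with z' ⟨w', ⟨hw1, hw2, hw3⟩, hc⟩
    exact ⟨_, hw2, hc.step ⟨e, he, by rw [e.right_inv hw3], hw1⟩⟩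

end

/-! ### From horizontal paths to plaque chains -/

section

/-- Used with `A` the plaque differential at a fixed point: for the frozen metric, displacement is
at most length. -/
theorem enorm_linearMap_sub_le_lintegral {E V : Type*} [NormedAddCommGroup E] [NormedSpace ℝ E]
    [FiniteDimensional ℝ E] [NormedAddCommGroup V] [NormedSpace ℝ V] (A : E →ₗ[ℝ] V) {f : ℝ → E}
    {a b : ℝ} (hf : ContDiffOn ℝ 1 f (Icc a b)) (hab : a ≤ b) :
    ‖A (f b - f a)‖ₑ ≤ ∫⁻ x in Ioo a b, ‖A (deriv f x)‖ₑ := by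
  have h := enorm_sub_le_lintegral_deriv_of_contDiffOn_Icc
    (A.toContinuousLinearMap.contDiff.comp_contDiffOn hf) hab
  rw [← restrict_Ioo_eq_restrict_Icc] at h
  rw [map_sub]
  refine h.trans_eq (setLIntegral_congr_fun measurableSet_Ioo fun x hx => ?_)
  have hx' : DifferentiableAt ℝ f x :=
    ((hf x ⟨hx.1.le, hx.2.le⟩).contDiffAt (Icc_mem_nhds hx.1 hx.2)).differentiableAt one_ne_zero
  have := (A.toContinuousLinearMap.hasFDerivAt.comp_hasDerivAt x hx'.hasDerivAt).deriv
  exact congrArg enorm this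

/-- `plaqueVec` as a linear map. -/
def plaqueLinearMap (e : OpenPartialHomeomorph N (PlaqueModel n d)) (q : PlaqueModel n d) :
    EuclideanSpace ℝ (Fin d) →ₗ[ℝ] TangentSpace (𝓡 n) (e.symm q) where
  toFun := plaqueVec e q
  map_add' v w := by
    have h0 : ((v + w, 0) : PlaqueModel n d) = (v, 0) + (w, 0) := by simp
    exact (congrArg (mfderiv 𝓘(ℝ, PlaqueModel n d) (𝓡 n) e.symm q) h0).trans
      ((mfderiv 𝓘(ℝ, PlaqueModel n d) (𝓡 n) e.symm q).map_add
        ((v, 0) : PlaqueModel n d) ((w, 0) : PlaqueModel n d))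
  map_smul' c v := plaqueVec_smul e q c v

/-- Velocity of a horizontal path, read in a foliation chart. -/
theorem IsSmoothHorizontalPath.hasDerivWithinAt {F : AnalyticFoliation n d N} {φ : ℝ → N}
    (hφ : F.IsSmoothHorizontalPath φ) {e : OpenPartialHomeomorph N (PlaqueModel n d)}
    (he : e ∈ F.charts) {t : ℝ} (ht : t ∈ Icc (0 : ℝ) 1) (hs : φ t ∈ e.source) :
    ∃ v : EuclideanSpace ℝ (Fin d),
      HasDerivWithinAt (fun s => e (φ s)) ((v, 0) : PlaqueModel n d) (Icc 0 1) t ∧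
      mfderiv 𝓘(ℝ, PlaqueModel n d) (𝓡 n) e.symm (e (φ t)) ((v, 0) : PlaqueModel n d) =
        mfderivWithin 𝓘(ℝ, ℝ) (𝓡 n) φ (Icc 0 1) t (1 : ℝ) := by
  have h1 := (hφ.1.mdifferentiableOn (by simp) t ht).hasMFDerivWithinAt
  have h2 := (F.mdifferentiableAt_chart he hs).hasMFDerivAt
  have h3 := (h2.comp_hasMFDerivWithinAt t h1).hasFDerivWithinAt
  have h4 := hφ.2 t ht e he hs
  obtain ⟨w, hw⟩ : ∃ w : PlaqueModel n d, w =
    mfderiv (𝓡 n) 𝓘(ℝ, PlaqueModel n d) e (φ t)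
      (mfderivWithin 𝓘(ℝ, ℝ) (𝓡 n) φ (Icc 0 1) t (1 : ℝ)) := ⟨_, rfl⟩
  have hw0 : w = (w.1, 0) := Prod.ext rfl (by rw [hw]; exact h4)
  refine ⟨w.1, ?_, ?_⟩
  · rw [← hw0, hw]
    exact HasFDerivWithinAt.hasDerivWithinAt (F := PlaqueModel n d) (f := fun s => e (φ s)) h3
  · rw [← hw0, hw]
    exact F.mfderiv_symm_chart_apply he hs _

variable [RiemannianBundle (fun x : N => TangentSpace (𝓡 n) x)]
theorem norm_tangentSpace_congr {x y : N} (h : x = y) {v : TangentSpace (𝓡 n) x}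
    {w : TangentSpace (𝓡 n) y} (hvw : (v : EuclideanSpace ℝ (Fin n)) = w) : ‖v‖ = ‖w‖ := by
  subst h
  exact congrArg norm hvw

theorem plaqueSpeed_eq_norm_mfderiv
    {e : OpenPartialHomeomorph N (PlaqueModel n d)} {φ : ℝ → N} {t : ℝ} (hs : φ t ∈ e.source)
    {v : EuclideanSpace ℝ (Fin d)} {w : TangentSpace (𝓡 n) (φ t)}
    (h : mfderiv 𝓘(ℝ, PlaqueModel n d) (𝓡 n) e.symm (e (φ t)) ((v, 0) : PlaqueModel n d) = w) :
    plaqueSpeed e (e (φ t)) v = ‖w‖ :=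
  norm_tangentSpace_congr (e.left_inv hs) h

variable [IsManifold (𝓡 n) ω N] [IsContMDiffRiemannianBundle (𝓡 n) ∞ (EuclideanSpace ℝ (Fin n))
      (fun x : N => TangentSpace (𝓡 n) x)]

/-- The factor 4 is 2 times 2: the metric is compared with its value at `φ t₀` once along the path
and once along the segment that replaces it. -/
theorem IsSmoothHorizontalPath.exists_plaqueStep {F : AnalyticFoliation n d N} {φ : ℝ → N}
    (hφ : F.IsSmoothHorizontalPath φ) {t₀ : ℝ} (ht₀ : t₀ ∈ Icc (0 : ℝ) 1) :
    ∃ δ > 0, ∀ s t, s ≤ t → s ∈ Icc (0 : ℝ) 1 ∩ ball t₀ δ → t ∈ Icc (0 : ℝ) 1 ∩ ball t₀ δ →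
      ∀ c, 4 * Manifold.pathELength (𝓡 n) φ s t < c → F.PlaqueStep (φ s) (φ t) c := by
  obtain ⟨e, he, hx⟩ := F.cover (φ t₀)
  obtain ⟨ρ, hρ, hball⟩ := Metric.eventually_nhds_iff_ball.1
    ((F.eventually_plaqueSpeed_le he (e.map_source hx)).and
      (e.open_target.mem_nhds (e.map_source hx)))
  have hcont : ContinuousWithinAt φ (Icc 0 1) t₀ := hφ.1.continuousOn t₀ ht₀
  have hev : ∀ᶠ τ in 𝓝[Icc 0 1] t₀, φ τ ∈ e.source ∧ e (φ τ) ∈ ball (e (φ t₀)) ρ :=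
    (hcont.eventually_mem (e.open_source.mem_nhds hx)).and
      (((e.continuousAt hx).comp_continuousWithinAt hcont).eventually_mem
        (ball_mem_nhds _ hρ))
  obtain ⟨δ, hδ, hδ'⟩ := Metric.mem_nhdsWithin_iff.1 hev
  refine ⟨δ, hδ, fun s t hst hs ht c hc => ?_⟩
  have hsub : Icc s t ⊆ ball t₀ δ ∩ Icc 0 1 := fun τ hτ =>
    ⟨(convex_ball t₀ δ).ordConnected.out hs.2 ht.2 hτ, hs.1.1.trans hτ.1, hτ.2.trans ht.1.2⟩
  have hsrc : ∀ τ ∈ Icc s t, φ τ ∈ e.source := fun τ hτ => (hδ' (hsub hτ)).1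
  have hq : ∀ τ ∈ Icc s t, e (φ τ) ∈ ball (e (φ t₀)) ρ := fun τ hτ => (hδ' (hsub hτ)).2
  have hsm : s ∈ Icc s t := left_mem_Icc.2 hst
  have htm : t ∈ Icc s t := right_mem_Icc.2 hst
  have hd := fun τ (hτ : τ ∈ Icc s t) => hφ.hasDerivWithinAt he (hsub hτ).2 (hsrc τ hτ)
  choose! v hv hv' using hd
  have hsub1 : Icc s t ⊆ Icc 0 1 := fun τ hτ => (hsub hτ).2
  -- Horizontality makes the transverse component of the velocity vanish, so the height is constant.
  have hheight : (e (φ s)).2 = (e (φ t)).2 := by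
    have h2 : ∀ τ ∈ Icc s t, HasDerivWithinAt (fun s => (e (φ s)).2) 0 (Icc s t) τ :=
      fun τ hτ => ((hv τ hτ).mono hsub1).snd
    refine (constant_of_derivWithin_zero (fun τ hτ => (h2 τ hτ).differentiableWithinAt)
      (fun τ hτ => ?_) t htm).symm
    exact (h2 τ ⟨hτ.1, hτ.2.le⟩).derivWithin
      (uniqueDiffOn_Icc (hτ.1.trans_lt hτ.2) τ ⟨hτ.1, hτ.2.le⟩)
  refine ⟨e, he, hheight, hsrc s hsm, hsrc t htm, fun r hr => ?_⟩
  have hqr : AffineMap.lineMap (e (φ s)) (e (φ t)) r ∈ ball (e (φ t₀)) ρ :=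
    (convex_ball _ _).lineMap_mem (hq s hsm) (hq t htm) hr
  have hCD : ContDiffOn ℝ 1 (fun τ => (e (φ τ)).1) (Icc s t) := by
    have h1 : ContMDiffOn 𝓘(ℝ, ℝ) 𝓘(ℝ, PlaqueModel n d) 1 (fun τ => e (φ τ)) (Icc s t) :=
      ((F.analytic e he).of_le (by simp)).comp ((hφ.1.of_le (by simp)).mono hsub1) hsrc
    exact h1.contDiffOn.fst
  have hint := enorm_linearMap_sub_le_lintegral (plaqueLinearMap e (e (φ t₀))) hCD hst
  have hlen : ∫⁻ x in Ioo s t, ‖plaqueLinearMap e (e (φ t₀)) (deriv (fun τ => (e (φ τ)).1) x)‖ₑ ≤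
      2 * Manifold.pathELength (𝓡 n) φ s t := by
    rw [Manifold.pathELength_eq_lintegral_mfderiv_Ioo, ← lintegral_const_mul' _ _ (by simp)]
    refine setLIntegral_mono' measurableSet_Ioo fun τ hτ => ?_
    have hτ' := Ioo_subset_Icc_self hτ
    have hnhds : Icc (0 : ℝ) 1 ∈ 𝓝 τ :=
      mem_of_superset (Icc_mem_nhds hτ.1 hτ.2) hsub1
    have hder : deriv (fun τ => (e (φ τ)).1) τ = v τ :=
      HasDerivAt.deriv ((hv τ hτ').hasDerivAt hnhds).fst
    have hsp := ((hball _ (hq τ hτ')).1 (v τ)).2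
    rw [plaqueSpeed_eq_norm_mfderiv (hsrc τ hτ') (hv' τ hτ'),
      mfderivWithin_of_mem_nhds hnhds] at hsp
    rw [hder]
    have := ENNReal.ofReal_le_ofReal hsp
    rw [ENNReal.ofReal_mul (by simp)] at this
    rw [ofReal_norm] at this
    refine le_trans (le_of_eq ?_) (this.trans (le_of_eq ?_))
    · exact (ofReal_norm _).symm
    · exact congrArg₂ (· * ·) (by simp) rfl
  have h1 := ((hball _ hqr).1 ((e (φ t)).1 - (e (φ s)).1)).1
  calc ENNReal.ofReal _ ≤ ENNReal.ofReal (2 * plaqueSpeed e (e (φ t₀)) _) :=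
        ENNReal.ofReal_le_ofReal h1
    _ = 2 * ‖plaqueLinearMap e (e (φ t₀)) ((e (φ t)).1 - (e (φ s)).1)‖ₑ := by
        rw [ENNReal.ofReal_mul (by simp)]
        refine congrArg₂ _ (by simp) ?_
        exact ofReal_norm _
    _ ≤ 2 * (2 * Manifold.pathELength (𝓡 n) φ s t) := by
        gcongr
        exact hint.trans hlen
    _ = 4 * Manifold.pathELength (𝓡 n) φ s t := by
        rw [← mul_assoc]; norm_num
    _ < c := hc

/-- Compactness of `[0,1]` gives a finite subdivision into plaque steps. The slack `ε` pays for the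
strict inequality in each step. -/
theorem Related.plaqueChain {F : AnalyticFoliation n d N} {l : ℝ} {x y : N}
    (h : F.Related l x y) {ε : ℝ≥0∞} (hε : 0 < ε) :
    ∃ c ≤ 4 * ENNReal.ofReal l + ε, F.PlaqueChain x y c := by
  obtain ⟨φ, hφ, rfl, rfl, hl⟩ := h
  have hfin : ∀ s ∈ Icc (0 : ℝ) 1, ∀ t ∈ Icc (0 : ℝ) 1,
      4 * Manifold.pathELength (𝓡 n) φ s t ≠ ⊤ := fun s hs t ht =>
    ENNReal.mul_ne_top (by simp) (((Manifold.pathELength_mono hs.1 ht.2).trans hl).trans_lt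
      ENNReal.ofReal_lt_top).ne
  choose! δ hδ hstep using fun t₀ (ht₀ : t₀ ∈ Icc (0 : ℝ) 1) => hφ.exists_plaqueStep ht₀
  obtain ⟨t, ht0, htm, ⟨m, hm⟩, ht⟩ := exists_monotone_Icc_subset_open_cover_Icc zero_le_one
    (c := fun i : Icc (0 : ℝ) 1 => {s | (s : ℝ) ∈ ball (i : ℝ) (δ i)})
    (fun i => isOpen_ball.preimage continuous_subtype_val)
    (fun i _ => mem_iUnion.2 ⟨i, mem_ball_self (hδ i i.2)⟩)
  -- Quantifying over all `ε` inside the induction lets half of the slack go to the last step.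
  have key : ∀ k : ℕ, ∀ ε > 0, ∃ c ≤ 4 * Manifold.pathELength (𝓡 n) φ 0 (t k) + ε,
      F.PlaqueChain (φ 0) (φ (t k)) c := by
    intro k
    induction k with
    | zero => intro ε _; exact ⟨0, zero_le, by rw [ht0]; exact .refl⟩
    | succ k ih =>
      intro ε hε
      obtain ⟨c, hc, hch⟩ := ih (ε / 2) (ENNReal.half_pos hε.ne')
      obtain ⟨i, hi⟩ := ht k
      have hle := htm (Nat.le_succ k)
      have hs := hstep i i.2 (t k) (t (k + 1)) hle ⟨(t k).2, hi (left_mem_Icc.2 hle)⟩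
        ⟨(t (k + 1)).2, hi (right_mem_Icc.2 hle)⟩
        (4 * Manifold.pathELength (𝓡 n) φ (t k) (t (k + 1)) + ε / 2)
        (ENNReal.lt_add_right (hfin _ (t k).2 _ (t (k + 1)).2) (ENNReal.half_pos hε.ne').ne')
      refine ⟨_, (add_le_add_left hc _).trans (le_of_eq ?_), hch.step hs⟩
      rw [← Manifold.pathELength_add (t k).2.1 (show (t k : ℝ) ≤ t (k + 1) from hle), mul_add,
        add_add_add_comm, ENNReal.add_halves]
  obtain ⟨c, hc, hch⟩ := key m ε hε
  rw [hm m le_rfl] at hc hch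
  exact ⟨c, hc.trans (by gcongr), hch⟩

end

/-! ### From plaque chains to points of horizontal balls -/

section

/-- A `C^1` path `ℝ → N` that locally stays in a plaque. -/
def IsLeafPath (F : AnalyticFoliation n d N) (φ : ℝ → N) : Prop :=
  ContMDiff 𝓘(ℝ, ℝ) (𝓡 n) 1 φ ∧
    ∀ t, ∃ e ∈ F.charts, φ t ∈ e.source ∧ ∀ᶠ s in 𝓝 t, (e (φ s)).2 = (e (φ t)).2

theorem IsLeafPath.comp {F : AnalyticFoliation n d N} {φ : ℝ → N} (hφ : F.IsLeafPath φ)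
    {g : ℝ → ℝ} (hg : ContDiff ℝ 1 g) : F.IsLeafPath (φ ∘ g) := by
  refine ⟨hφ.1.comp hg.contMDiff, fun t => ?_⟩
  obtain ⟨e, he, hs, h⟩ := hφ.2 (g t)
  exact ⟨e, he, hs, hg.continuous.continuousAt.eventually h⟩

/-- Nearby times share a plaque, so the times spent in a given leaf form a clopen subset of the
connected line. -/
theorem IsLeafPath.mem_leaf {F : AnalyticFoliation n d N} {φ : ℝ → N} (hφ : F.IsLeafPath φ)
    (a t : ℝ) : φ t ∈ F.leaf (φ a) := by
  have hloc : ∀ t, ∀ᶠ s in 𝓝 t, F.SamePlaque (φ t) (φ s) ∧ F.SamePlaque (φ s) (φ t) := by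
    intro t
    obtain ⟨e, he, hs, h⟩ := hφ.2 t
    filter_upwards [h, hφ.1.continuous.continuousAt.eventually_mem (e.open_source.mem_nhds hs)]
      with s h1 h2
    exact ⟨⟨e, he, hs, h2, h1.symm⟩, ⟨e, he, h2, hs, h1⟩⟩
  have hclopen : IsClopen {t | φ t ∈ F.leaf (φ a)} := by
    constructor
    · rw [← isOpen_compl_iff, isOpen_iff_mem_nhds]
      intro t ht
      filter_upwards [hloc t] with s hs hs'
      exact ht (Relation.ReflTransGen.tail hs' hs.2)
    · rw [isOpen_iff_mem_nhds]
      intro t ht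
      filter_upwards [hloc t] with s hs
      exact Relation.ReflTransGen.tail ht hs.1
  have := hclopen.eq_univ ⟨a, Relation.ReflTransGen.refl⟩
  exact this.symm.subset (mem_univ t)

theorem IsLeafPath.isLeafwiseACPath {F : AnalyticFoliation n d N} {φ : ℝ → N}
    (hφ : F.IsLeafPath φ) : F.IsLeafwiseACPath φ := by
  intro t ht
  obtain ⟨e, he, hs, h⟩ := hφ.2 t
  obtain ⟨δ, hδ, hball⟩ := Metric.nhds_basis_closedBall.eventually_iff.1
    ((hφ.1.continuous.continuousAt.eventually_mem (e.open_source.mem_nhds hs)).and h)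
  have hsub : Icc (max 0 (t - δ)) (min 1 (t + δ)) ⊆ closedBall t δ := by
    rw [Real.closedBall_eq_Icc]
    exact Icc_subset_Icc (le_max_right _ _) (min_le_right _ _)
  refine ⟨e, he, δ, hδ, fun s hs => hball (hsub hs), ?_⟩
  have hle : max 0 (t - δ) ≤ min 1 (t + δ) := by
    simp only [max_le_iff, le_min_iff]
    exact ⟨⟨zero_le_one, by linarith [ht.2]⟩, by linarith [ht.1], by linarith⟩
  refine ContDiffOn.absolutelyContinuousOnInterval ?_
  rw [uIcc_of_le hle]
  have h1 : ContMDiffOn 𝓘(ℝ, ℝ) 𝓘(ℝ, PlaqueModel n d) 1 (fun τ => e (φ τ))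
      (Icc (max 0 (t - δ)) (min 1 (t + δ))) :=
    ((F.analytic e he).of_le (by simp)).comp hφ.1.contMDiffOn fun τ hτ => (hball (hsub hτ)).1
  exact h1.contDiffOn.fst

variable [RiemannianBundle (fun x : N => TangentSpace (𝓡 n) x)]

/-- A leafwise `C^1` path of length at most `c`, constant outside a compact interval, joins `x`
to `y`. -/
def LeafJoined (F : AnalyticFoliation n d N) (x y : N) (c : ℝ≥0∞) : Prop :=
  ∃ (φ : ℝ → N) (a b : ℝ), a ≤ b ∧ F.IsLeafPath φ ∧ (∀ t ≤ a, φ t = x) ∧ (∀ t ≥ b, φ t = y) ∧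
    Manifold.pathELength (𝓡 n) φ a b ≤ c

theorem IsLeafPath.pathELength_comp {F : AnalyticFoliation n d N} {φ : ℝ → N}
    (hφ : F.IsLeafPath φ) {g : ℝ → ℝ} (hg : Monotone g) (hg' : Differentiable ℝ g) {a b : ℝ}
    (hab : a ≤ b) :
    Manifold.pathELength (𝓡 n) (φ ∘ g) a b = Manifold.pathELength (𝓡 n) φ (g a) (g b) :=
  Manifold.pathELength_comp_of_monotoneOn hab (hg.monotoneOn _) hg'.differentiableOn
    (hφ.1.mdifferentiable one_ne_zero).mdifferentiableOn

theorem LeafJoined.trans {F : AnalyticFoliation n d N} {x y z : N} {c c' : ℝ≥0∞}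
    (h : F.LeafJoined x y c) (h' : F.LeafJoined y z c') : F.LeafJoined x z (c + c') := by
  obtain ⟨φ, a, b, hab, hφ, hx, hy, hl⟩ := h
  obtain ⟨φ', a', b', hab', hφ', hx', hy', hl'⟩ := h'
  -- The second path is shifted to start at `b + 1`. Both paths then equal `y` on `[b, b + 1]`, so
  -- the concatenation is `C^1` and the gap adds no length.
  have hg : ContDiff ℝ 1 fun t : ℝ => t + (a' - (b + 1)) := by fun_prop
  have hψ' := hφ'.comp hg
  set φ'' : ℝ → N := φ' ∘ fun t : ℝ => t + (a' - (b + 1)) with hφ''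
  classical
  let ψ : ℝ → N := fun t => if t < b + 1 then φ t else φ'' t
  have h1 : ∀ t < b + 1, ψ t = φ t := fun t ht => if_pos ht
  have h2 : ∀ t > b, ψ t = φ'' t := by
    intro t ht
    by_cases htb : t < b + 1
    · rw [h1 t htb, hy t ht.le]
      exact (hx' _ (by linarith)).symm
    · exact if_neg htb
  have e1 : ∀ t < b + 1, ψ =ᶠ[𝓝 t] φ := fun t ht => by
    filter_upwards [Iio_mem_nhds ht] with s hs using h1 s hs
  have e2 : ∀ t > b, ψ =ᶠ[𝓝 t] φ'' := fun t ht => by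
    filter_upwards [Ioi_mem_nhds ht] with s hs using h2 s hs
  refine ⟨ψ, a, b + 1 + (b' - a'), by linarith, ⟨fun t => ?_, fun t => ?_⟩, fun t ht => ?_,
    fun t ht => ?_, ?_⟩
  · rcases lt_or_ge t (b + 1) with ht | ht
    · exact (hφ.1 t).congr_of_eventuallyEq (e1 t ht)
    · exact (hψ'.1 t).congr_of_eventuallyEq (e2 t (by linarith))
  · rcases lt_or_ge t (b + 1) with ht | ht
    · obtain ⟨e, he, hs, h⟩ := hφ.2 t
      refine ⟨e, he, by rwa [h1 t ht], ?_⟩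
      filter_upwards [h, e1 t ht] with s hs1 hs2
      rw [hs2, hs1, h1 t ht]
    · have ht' : t > b := by linarith
      obtain ⟨e, he, hs, h⟩ := hψ'.2 t
      refine ⟨e, he, by rwa [h2 t ht'], ?_⟩
      filter_upwards [h, e2 t ht'] with s hs1 hs2
      rw [hs2, hs1, h2 t ht']
  · rw [h1 t (by linarith), hx t ht]
  · rw [h2 t (by linarith)]
    exact hy' _ (by simp only; linarith)
  · rw [← Manifold.pathELength_add (b := b) hab (by linarith),
      ← Manifold.pathELength_add (a := b) (b := b + 1) (by linarith) (by linarith)]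
    have l1 : Manifold.pathELength (𝓡 n) ψ a b ≤ c := by
      rw [Manifold.pathELength_congr_Ioo (γ' := φ) fun t ht => h1 t (by linarith [ht.2])]
      exact hl
    have l2 : Manifold.pathELength (𝓡 n) ψ b (b + 1) = 0 := by
      rw [Manifold.pathELength_congr_Ioo (γ' := fun _ => y) fun t ht => ?_]
      · simp [Manifold.pathELength]
      · exact (h1 t ht.2).trans (hy t ht.1.le)
    have l3 : Manifold.pathELength (𝓡 n) ψ (b + 1) (b + 1 + (b' - a')) ≤ c' := by
      rw [Manifold.pathELength_congr_Ioo (γ' := φ'') fun t ht => h2 t (by linarith [ht.1]), hφ'',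
        hφ'.pathELength_comp (fun s t h => by simpa using h) (by fun_prop) (by linarith)]
      convert hl' using 2 <;> ring
    rw [l2, zero_add]
    exact add_le_add l1 l3

theorem LeafJoined.mem_horizontalBall {F : AnalyticFoliation n d N} {x y : N} {l : ℝ}
    (h : F.LeafJoined x y (ENNReal.ofReal l)) : y ∈ F.horizontalBall x l := by
  obtain ⟨φ, a, b, hab, hφ, hx, hy, hl⟩ := h
  have hg : ContDiff ℝ 1 fun t : ℝ => t * (b - a) + a := by fun_prop
  have hψ := hφ.comp hg
  have h0 : (φ ∘ fun t : ℝ => t * (b - a) + a) 0 = x := hx _ (by simp)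
  have h1 : (φ ∘ fun t : ℝ => t * (b - a) + a) 1 = y := hy _ (by simp)
  have hleaf := fun t => h0 ▸ hψ.mem_leaf 0 t
  refine ⟨h1 ▸ hleaf 1, _, hψ.isLeafwiseACPath, fun t _ => hleaf t, h0, h1, ?_⟩
  rw [hφ.pathELength_comp (fun s t h => by
    have : 0 ≤ b - a := sub_nonneg.2 hab
    gcongr) (by fun_prop) zero_le_one]
  convert hl using 2 <;> ring

variable {F : AnalyticFoliation n d N}

theorem LeafJoined.refl (x : N) : F.LeafJoined x x 0 := by
  obtain ⟨e, he, hx⟩ := F.cover x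
  exact ⟨fun _ => x, 0, 0, le_rfl, ⟨contMDiff_const, fun _ => ⟨e, he, hx, by simp⟩⟩, by simp,
    by simp, by simp⟩

/-- The coordinate segment has speed below `c` on a unit interval. Running it through
`Real.smoothTransition` makes it constant outside `[0,1]` without changing its length. -/
theorem PlaqueStep.leafJoined {z w : N} {c : ℝ≥0∞} (h : F.PlaqueStep z w c) :
    F.LeafJoined z w c := by
  obtain ⟨e, he, hh, hz, hw, hs⟩ := h
  have hl : ∀ s ∈ Icc (0 : ℝ) 1, (AffineMap.lineMap (e z) (e w) s : PlaqueModel n d) ∈ e.target :=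
    fun s hs => F.lineMap_mem_target he (e.map_source hz) (e.map_source hw) hs
  have hl2 : ∀ s : ℝ, (AffineMap.lineMap (e z) (e w) s : PlaqueModel n d).2 = (e z).2 := by
    intro s
    simp [AffineMap.lineMap_apply_module', hh]
  have hχ : ∀ t, Real.smoothTransition t ∈ Icc (0 : ℝ) 1 := fun t =>
    ⟨Real.smoothTransition.nonneg t, Real.smoothTransition.le_one t⟩
  have hγ : ∀ s ∈ Icc (0 : ℝ) 1, ContMDiffAt 𝓘(ℝ, ℝ) (𝓡 n) 1
      (fun s : ℝ => e.symm (AffineMap.lineMap (e z) (e w) s)) s := by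
    intro s hs
    have h1 : ContMDiffAt 𝓘(ℝ, ℝ) 𝓘(ℝ, PlaqueModel n d) 1
        (fun s : ℝ => (AffineMap.lineMap (e z) (e w) s : PlaqueModel n d)) s := by
      have : ContDiff ℝ 1 (fun s : ℝ => (AffineMap.lineMap (e z) (e w) s : PlaqueModel n d)) := by
        simp only [AffineMap.lineMap_apply_module]
        fun_prop
      exact this.contMDiff s
    exact ContMDiffAt.comp s (((F.analytic_symm e he).contMDiffAt
      (e.open_target.mem_nhds (hl s hs))).of_le (by simp)) h1
  refine ⟨(fun s : ℝ => e.symm (AffineMap.lineMap (e z) (e w) s)) ∘ Real.smoothTransition, 0, 1,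
    zero_le_one, ⟨fun t => ?_, fun t => ?_⟩, fun t ht => ?_, fun t ht => ?_, ?_⟩
  · exact ContMDiffAt.comp t (hγ _ (hχ t)) Real.smoothTransition.contDiff.contMDiff.contMDiffAt
  · refine ⟨e, he, e.map_target (hl _ (hχ t)), Eventually.of_forall fun s => ?_⟩
    simp only [Function.comp]
    rw [e.right_inv (hl _ (hχ t)), e.right_inv (hl _ (hχ s)), hl2, hl2]
  · simp [Real.smoothTransition.zero_of_nonpos ht, e.left_inv hz]
  · simp [Real.smoothTransition.one_of_one_le ht, e.left_inv hw]
  · rw [Manifold.pathELength_comp_of_monotoneOn zero_le_one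
      (Real.smoothTransition.monotone.monotoneOn _)
      (Real.smoothTransition.contDiff (n := 1)).differentiable_one.differentiableOn,
      Real.smoothTransition.zero, Real.smoothTransition.one]
    · rw [Manifold.pathELength_eq_lintegral_mfderiv_Icc]
      calc _ ≤ ∫⁻ _ in Icc (0 : ℝ) 1, c := by
            refine setLIntegral_mono' measurableSet_Icc fun s hs' => ?_
            refine le_trans (le_of_eq ?_) (hs s hs').le
            have hd : HasDerivAt (fun s : ℝ => (AffineMap.lineMap (e z) (e w) s : PlaqueModel n d))
                (e w - e z) s := AffineMap.hasDerivAt_lineMap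
            have hc := HasMFDerivAt.comp s
              (F.mdifferentiableAt_chart_symm he (hl s hs')).hasMFDerivAt
              hd.hasFDerivAt.hasMFDerivAt
            have hv : e w - e z = ((e w).1 - (e z).1, 0) := Prod.ext rfl (by simp [hh])
            have hv' : (mfderiv 𝓘(ℝ, ℝ) (𝓡 n)
                (fun s : ℝ => e.symm (AffineMap.lineMap (e z) (e w) s))
                s (1 : ℝ) : EuclideanSpace ℝ (Fin n)) =
                plaqueVec e (AffineMap.lineMap (e z) (e w) s) ((e w).1 - (e z).1) := by
              have h3 := DFunLike.congr_fun hc.mfderiv (1 : ℝ)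
              refine h3.trans ?_
              refine congrArg (mfderiv 𝓘(ℝ, PlaqueModel n d) (𝓡 n) e.symm
                (AffineMap.lineMap (e z) (e w) s)) ?_
              exact (one_smul ℝ (e w - e z)).trans hv
            exact (congrArg enorm hv').trans (ofReal_norm _).symm
        _ = c := by simp
    · rw [Real.smoothTransition.zero, Real.smoothTransition.one]
      exact fun s hs => ((hγ s hs).mdifferentiableAt one_ne_zero).mdifferentiableWithinAt

theorem PlaqueChain.leafJoined {z w : N} {c : ℝ≥0∞} (h : F.PlaqueChain z w c) :
    F.LeafJoined z w c := by
  induction h with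
  | refl => exact .refl z
  | step _ hs ih => exact ih.trans hs.leafJoined

theorem LeafJoined.mono {z w : N} {c c' : ℝ≥0∞} (h : F.LeafJoined z w c) (hc : c ≤ c') :
    F.LeafJoined z w c' := by
  obtain ⟨φ, a, b, hab, hφ, hx, hy, hl⟩ := h
  exact ⟨φ, a, b, hab, hφ, hx, hy, hl.trans hc⟩

end

/-! ### Transverse sections, plaque volume and non-accumulation of returns -/

section

theorem LocalTransverseSection.contMDiffAt {F : AnalyticFoliation n d N} {xbar : N}
    (S : F.LocalTransverseSection xbar) {u : EuclideanSpace ℝ (Fin (n - d))} (hu : u ∈ ball 0 1) :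
    ContMDiffAt (𝓡 (n - d)) (𝓡 n) ∞ S.param u :=
  S.contMDiffOn.contMDiffAt (isOpen_ball.mem_nhds hu)

/-- The height in a foliation chart is a local coordinate on a transverse section. -/
theorem LocalTransverseSection.hasStrictFDerivAt_height {F : AnalyticFoliation n d N} {xbar : N}
    (S : F.LocalTransverseSection xbar) {u : EuclideanSpace ℝ (Fin (n - d))} (hu : u ∈ ball 0 1)
    {e : OpenPartialHomeomorph N (PlaqueModel n d)} (he : e ∈ F.charts)
    (hs : S.param u ∈ e.source) :
    ∃ L : EuclideanSpace ℝ (Fin (n - d)) ≃L[ℝ] EuclideanSpace ℝ (Fin (n - d)),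
      HasStrictFDerivAt (fun b => (e (S.param b)).2)
        (L : EuclideanSpace ℝ (Fin (n - d)) →L[ℝ] EuclideanSpace ℝ (Fin (n - d))) u := by
  have h1 : ContMDiffAt (𝓡 (n - d)) 𝓘(ℝ, PlaqueModel n d) ∞ (fun b => e (S.param b)) u :=
    ContMDiffAt.comp u (((F.analytic e he).contMDiffAt (e.open_source.mem_nhds hs)).of_le (by simp))
      (S.contMDiffAt hu)
  have h2 : HasStrictFDerivAt (fun b => (e (S.param b)).2) _ u :=
    (h1.contDiffAt.hasStrictFDerivAt (by simp)).snd
  have h3 : ∀ v : EuclideanSpace ℝ (Fin (n - d)), fderiv ℝ (fun b => e (S.param b)) u v =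
      mfderiv (𝓡 n) 𝓘(ℝ, PlaqueModel n d) e (S.param u)
        (mfderiv (𝓡 (n - d)) (𝓡 n) S.param u v) := by
    intro v
    have := mfderiv_comp u (F.mdifferentiableAt_chart he hs)
      ((S.contMDiffAt hu).mdifferentiableAt (by simp))
    rw [mfderiv_eq_fderiv] at this
    exact DFunLike.congr_fun this v
  set L := (ContinuousLinearMap.snd ℝ (EuclideanSpace ℝ (Fin d))
    (EuclideanSpace ℝ (Fin (n - d)))).comp (fderiv ℝ (fun b => e (S.param b)) u)
  -- Lift `(0, w)` to a tangent vector and split it by transversality; the leaf part has no height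
  -- component, so the section part is mapped to `w`. Equality of dimensions then gives injectivity.
  have hsurj : Function.Surjective L := by
    intro w
    obtain ⟨τ, hτ⟩ : ∃ τ : TangentSpace (𝓡 n) (S.param u),
        mfderiv (𝓡 n) 𝓘(ℝ, PlaqueModel n d) e (S.param u) τ = ((0, w) : PlaqueModel n d) := by
      have := F.mfderiv_chart_symm_apply he (e.map_source hs) (0, w)
      rw [e.left_inv hs] at this
      exact ⟨_, this⟩
    have hmem : τ ∈ F.tangent (S.param u) ⊔
      LinearMap.range (mfderiv (𝓡 (n - d)) (𝓡 n) S.param u :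
        TangentSpace (𝓡 (n - d)) u →ₗ[ℝ] TangentSpace (𝓡 n) (S.param u)) := by
      rw [S.transverse u hu]; trivial
    obtain ⟨α, hα, β, ⟨v, hv⟩, hαβ⟩ := Submodule.mem_sup.1 hmem
    refine ⟨v, ?_⟩
    have h4 := hα e he hs
    have h5 : (mfderiv (𝓡 n) 𝓘(ℝ, PlaqueModel n d) e (S.param u) α : PlaqueModel n d) +
        (mfderiv (𝓡 n) 𝓘(ℝ, PlaqueModel n d) e (S.param u) β : PlaqueModel n d) = (0, w) := by
      rw [← hτ, ← hαβ]
      exact (map_add _ α β).symm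
    have h6 : L v = (mfderiv (𝓡 n) 𝓘(ℝ, PlaqueModel n d) e (S.param u) β : PlaqueModel n d).2 := by
      rw [← hv]
      exact congrArg Prod.snd (h3 v)
    have h7 := congrArg Prod.snd h5
    rw [h6]
    refine Eq.trans ?_ h7
    refine (zero_add _).symm.trans ?_
    exact congrArg (· + _) h4.symm
  have hinj : Function.Injective L := LinearMap.injective_iff_surjective.2 hsurj
  let L' := (LinearEquiv.ofBijective L.toLinearMap ⟨hinj, hsurj⟩).toContinuousLinearEquiv
  refine ⟨L', h2.congr_fderiv ?_⟩
  ext1 v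
  rfl

theorem PlaquePiece.coordVec_eq {F : AnalyticFoliation n d N} (P : F.PlaquePiece)
    {u : EuclideanSpace ℝ (Fin d)} (hu : u ∈ P.params) (i : Fin d) :
    P.coordVec u i = plaqueVec P.chart (u, P.height) (EuclideanSpace.single i (1 : ℝ)) := by
  have h1 : HasFDerivAt (fun u : EuclideanSpace ℝ (Fin d) => ((u, P.height) : PlaqueModel n d))
      (ContinuousLinearMap.inl ℝ _ _) u := hasFDerivAt_prodMk_left u P.height
  have h2 := HasMFDerivAt.comp u
    (F.mdifferentiableAt_chart_symm P.chart_mem (P.mem_target u hu)).hasMFDerivAt h1.hasMFDerivAt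
  exact DFunLike.congr_fun h2.mfderiv (EuclideanSpace.single i (1 : ℝ))

variable [RiemannianBundle (fun x : N => TangentSpace (𝓡 n) x)]

/-- The density of the Riemannian volume of plaques in plaque coordinates. -/
def plaqueDensity (e : OpenPartialHomeomorph N (PlaqueModel n d)) (q : PlaqueModel n d) : ℝ :=
  Real.sqrt (Matrix.det (Matrix.of fun i j : Fin d =>
    (inner ℝ (plaqueVec e q (EuclideanSpace.single i (1 : ℝ)))
      (plaqueVec e q (EuclideanSpace.single j (1 : ℝ))) : ℝ)))

theorem PlaquePiece.riemannianVolume_eq {F : AnalyticFoliation n d N} (P : F.PlaquePiece) :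
    P.riemannianVolume =
      ∫⁻ u in P.params, ENNReal.ofReal (plaqueDensity P.chart (u, P.height)) := by
  refine setLIntegral_congr_fun P.measurableSet_params fun u hu => ?_
  simp only [P.coordVec_eq hu, plaqueDensity]
  rfl

/-- The determinant is the Gram determinant of the images of a basis under an injective linear map.
-/
theorem plaqueDensity_pos (F : AnalyticFoliation n d N)
    {e : OpenPartialHomeomorph N (PlaqueModel n d)} (he : e ∈ F.charts) {q : PlaqueModel n d}
    (hq : q ∈ e.target) : 0 < plaqueDensity e q := by
  refine Real.sqrt_pos.2 ?_
  have hker : LinearMap.ker (plaqueLinearMap e q) = ⊥ :=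
    LinearMap.ker_eq_bot'.2 fun v hv => F.plaqueVec_eq_zero he hq hv
  have hli := (EuclideanSpace.basisFun (Fin d) ℝ).toBasis.linearIndependent.map'
    (plaqueLinearMap e q) hker
  have hpd := (Matrix.posDef_gram_of_linearIndependent (𝕜 := ℝ) hli).det_pos
  refine lt_of_lt_of_eq hpd (congrArg Matrix.det ?_)
  ext i j
  simp [Matrix.gram_apply]
  rfl

variable [IsManifold (𝓡 n) ω N] [IsContMDiffRiemannianBundle (𝓡 n) ∞ (EuclideanSpace ℝ (Fin n))
      (fun x : N => TangentSpace (𝓡 n) x)]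

theorem continuousAt_plaqueDensity (F : AnalyticFoliation n d N)
    {e : OpenPartialHomeomorph N (PlaqueModel n d)} (he : e ∈ F.charts) {q : PlaqueModel n d}
    (hq : q ∈ e.target) : ContinuousAt (plaqueDensity e) q := by
  refine ContinuousAt.sqrt ?_
  simp only [Matrix.det_apply]
  refine tendsto_finsetSum _ fun σ _ => ContinuousAt.const_smul ?_ _
  refine tendsto_finsetProd _ fun i _ => ?_
  exact (F.continuousOn_inner_plaqueVec he _ _).continuousAt (e.open_target.mem_nhds hq)

/-- Points of a transverse section joined by short plaque chains do not accumulate, when horizontal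
balls have finite volume. -/
theorem LocalTransverseSection.eventually_not_plaqueChain {F : AnalyticFoliation n d N} {xbar : N}
    (S : F.LocalTransverseSection xbar) {a : EuclideanSpace ℝ (Fin (n - d))} (ha : a ∈ ball 0 1)
    {l : ℝ} (hl : 0 ≤ l) (hfin : F.leafVolume (F.horizontalBall (S.param a) (l + 1)) ≠ ⊤) :
    ∀ᶠ b in 𝓝 a, b ≠ a → ¬ ∃ c ≤ ENNReal.ofReal l, F.PlaqueChain (S.param a) (S.param b) c := by
  obtain ⟨e, he, hx⟩ := F.cover (S.param a)
  have hq := e.map_source hx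
  obtain ⟨L, hL⟩ := S.hasStrictFDerivAt_height ha he hx
  set f : EuclideanSpace ℝ (Fin (n - d)) → EuclideanSpace ℝ (Fin (n - d)) :=
    fun b => (e (S.param b)).2 with hf
  have hinj : InjOn f (hL.toOpenPartialHomeomorph f).source :=
    (hL.toOpenPartialHomeomorph f).injOn
  have hsrc := (hL.toOpenPartialHomeomorph f).open_source.mem_nhds
    hL.mem_toOpenPartialHomeomorph_source
  have hκ := F.plaqueDensity_pos he hq
  set κ := plaqueDensity e (e (S.param a)) / 2 with hκ'
  -- Choose a scale at which every point of a plaque disc is one step of cost 1 from its section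
  -- point, with density at least `κ`. This step is the `+ 1` in the radius `l + 1`.
  have hev : ∀ᶠ p in 𝓝 (S.param a, e (S.param a)),
      SegmentSpeedLT e p.1 (e.symm p.2) 1 ∧ p.2 ∈ e.target ∧ κ ≤ plaqueDensity e p.2 := by
    refine Eventually.and ?_ (Eventually.and ?_ ?_)
    · have hc : ContinuousAt (fun p : N × PlaqueModel n d => (p.1, e.symm p.2))
          (S.param a, e (S.param a)) :=
        continuousAt_fst.prodMk (ContinuousAt.comp (g := e.symm) (e.continuousAt_symm hq)
          continuousAt_snd)
      refine hc.eventually (p := fun p : N × N => SegmentSpeedLT e p.1 p.2 1) ?_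
      simp only [e.left_inv hx]
      exact F.eventually_segmentSpeedLT he (segmentSpeedLT_self hx one_pos)
    · exact continuousAt_snd.eventually_mem (e.open_target.mem_nhds hq)
    · refine continuousAt_snd.eventually (p := fun q => κ ≤ plaqueDensity e q) ?_
      exact (F.continuousAt_plaqueDensity he hq).eventually (lt_mem_nhds (half_lt_self hκ)) |>.mono
        fun _ h => h.le
  rw [nhds_prod_eq, eventually_prod_iff] at hev
  obtain ⟨p₁, hp₁, p₂, hp₂, hp⟩ := hev
  obtain ⟨ρ, hρ, hball⟩ := Metric.eventually_nhds_iff_ball.1 hp₂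
  have hcont : ContinuousAt S.param a := (S.contMDiffAt ha).continuousAt
  have hgood : ∀ᶠ b in 𝓝 a, b ∈ (hL.toOpenPartialHomeomorph f).source ∧ p₁ (S.param b) ∧
      f b ∈ ball (f a) ρ :=
    (eventually_mem_set.2 hsrc).and ((hcont.eventually hp₁).and
      (hL.continuousAt.eventually_mem (ball_mem_nhds _ hρ)))
  by_contra hcon
  -- The returning parameters where the height `f` is injective and the chosen scale applies;
  -- accumulation at `a` makes `B` infinite.
  set B : Set (EuclideanSpace ℝ (Fin (n - d))) := {b | (b ∈ (hL.toOpenPartialHomeomorph f).source ∧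
    p₁ (S.param b) ∧ f b ∈ ball (f a) ρ) ∧ b ≠ a ∧
    ∃ c ≤ ENNReal.ofReal l, F.PlaqueChain (S.param a) (S.param b) c} with hB
  have hinf : B.Infinite := by
    intro hBfin
    have haB : Bᶜ ∈ 𝓝 a := hBfin.isClosed.isOpen_compl.mem_nhds fun h => h.2.1 rfl
    refine hcon ?_
    filter_upwards [haB, hgood] with b hb hg hne hch
    exact hb ⟨hg, hne, hch⟩
  have hmem : ∀ b ∈ B, ∀ u ∈ ball (e (S.param a)).1 ρ,
      ((u, f b) : PlaqueModel n d) ∈ ball (e (S.param a)) ρ := by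
    intro b hb u hu
    rw [← ball_prod_same]
    exact ⟨hu, hb.1.2.2⟩
  set A := hinf.natEmbedding
  have hA : ∀ i, (A i : EuclideanSpace ℝ (Fin (n - d))) ∈ B := fun i => (A i).2
  let P : ℕ → F.PlaquePiece := fun i =>
    { chart := e
      chart_mem := he
      height := f (A i)
      params := ball (e (S.param a)).1 ρ
      measurableSet_params := measurableSet_ball
      mem_target := fun u hu => (hp (hA i).1.2.1 (hball _ (hmem _ (hA i) u hu))).2.1 }
  have hvol : ∀ i, ENNReal.ofReal κ * volume (ball (e (S.param a)).1 ρ) ≤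
      (P i).riemannianVolume := by
    intro i
    rw [PlaquePiece.riemannianVolume_eq, ← setLIntegral_const]
    refine setLIntegral_mono' measurableSet_ball fun u hu => ?_
    exact ENNReal.ofReal_le_ofReal (hp (hA i).1.2.1 (hball _ (hmem _ (hA i) u hu))).2.2
  have hsub : ∀ i, (P i).carrier ⊆ F.horizontalBall (S.param a) (l + 1) := by
    rintro i _ ⟨u, hu, rfl⟩
    obtain ⟨h1, h2, -⟩ := hp (hA i).1.2.1 (hball _ (hmem _ (hA i) u hu))
    obtain ⟨c, hc, hch⟩ := (hA i).2.2
    have hst : F.PlaqueStep (S.param (A i)) (e.symm (u, f (A i))) 1 :=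
      ⟨e, he, by rw [e.right_inv h2], h1⟩
    refine ((hch.step hst).leafJoined.mono ?_).mem_horizontalBall
    rw [ENNReal.ofReal_add hl zero_le_one, ENNReal.ofReal_one]
    gcongr
  have hdisj : Pairwise fun i j => Disjoint (P i).carrier (P j).carrier := by
    intro i j hij
    rw [Set.disjoint_left]
    rintro _ ⟨u, hu, rfl⟩ ⟨u', hu', h⟩
    have h1 := e.symm.injOn ((P j).mem_target u' hu') ((P i).mem_target u hu) h
    have h2 : (P j).height = (P i).height := (Prod.mk.inj h1).2
    have h3 := hinj (hA j).1.1 (hA i).1.1 h2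
    exact hij (A.injective (Subtype.ext h3)).symm
  have hpos : ENNReal.ofReal κ * volume (ball (e (S.param a)).1 ρ) ≠ 0 :=
    mul_ne_zero (ENNReal.ofReal_pos.2 (half_pos hκ)).ne' (measure_ball_pos _ _ hρ).ne'
  -- All discs have the same coordinate radius, hence a common lower volume bound; enough of them
  -- exceed the finite volume of the ball.
  obtain ⟨k, hk⟩ := ENNReal.exists_nat_mul_gt hpos hfin
  refine hk.not_ge ?_
  calc (k : ℝ≥0∞) * _ = ∑ _ : Fin k, _ := by simp
    _ ≤ ∑ i : Fin k, (P i).riemannianVolume := Finset.sum_le_sum fun i _ => hvol i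
    _ ≤ F.leafVolume (F.horizontalBall (S.param a) (l + 1)) := by
      refine le_iSup_of_le k (le_iSup_of_le (fun i => P i) (le_iSup_of_le ?_
        (le_iSup_of_le (fun i => hsub i) le_rfl)))
      exact fun i j hij => hdisj fun h => hij (Fin.ext h)

end

/-! ### Openness of the return set and extraction of the subset -/

section

variable [RiemannianBundle (fun x : N => TangentSpace (𝓡 n) x)]
variable [IsManifold (𝓡 n) ω N] [IsContMDiffRiemannianBundle (𝓡 n) ∞ (EuclideanSpace ℝ (Fin n))
      (fun x : N => TangentSpace (𝓡 n) x)]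

/-- The parameters of the points of a transverse section from which another point of the section,
at parameter distance less than `r`, is reached by a plaque chain of total cost at most `C`. -/
def LocalTransverseSection.returnSet {F : AnalyticFoliation n d N} {xbar : N}
    (S : F.LocalTransverseSection xbar) (C : ℝ≥0∞) (r : ℝ) :
    Set (EuclideanSpace ℝ (Fin (n - d))) :=
  {a | a ∈ ball 0 1 ∧ ∃ b ∈ ball 0 1, b ≠ a ∧ dist b a < r ∧
    ∃ c < C, F.PlaqueChain (S.param a) (S.param b) c}

/-- A chain transported from `a` to `a'` ends near `S.param b` but perhaps off `S`; one more short
plaque step slides it back to `S`. The strict bound `c < C` leaves room for the cost `ε` of that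
step. -/
theorem LocalTransverseSection.isOpen_returnSet {F : AnalyticFoliation n d N} {xbar : N}
    (S : F.LocalTransverseSection xbar) (C : ℝ≥0∞) (r : ℝ) : IsOpen (S.returnSet C r) := by
  rw [isOpen_iff_mem_nhds]
  rintro a ⟨ha, b, hb, hba, hr, c, hc, hch⟩
  obtain ⟨ε, hε, hcε⟩ := ENNReal.lt_iff_exists_add_pos_lt.1 hc
  have hε' : (0 : ℝ≥0∞) < ε := by exact_mod_cast hε
  obtain ⟨e, he, hy⟩ := F.cover (S.param b)
  obtain ⟨L, hL⟩ := S.hasStrictFDerivAt_height hb he hy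
  have hab : ∀ᶠ p in 𝓝 a ×ˢ 𝓝 b, p.2 ≠ p.1 ∧ dist p.2 p.1 < r := by
    rw [← nhds_prod_eq]
    exact Eventually.and ((isOpen_ne_fun continuous_snd continuous_fst).mem_nhds (x := (a, b)) hba)
      ((continuousAt_snd.dist continuousAt_fst).eventually (gt_mem_nhds hr))
  obtain ⟨p₁, hp₁, p₂, hp₂, hp⟩ := eventually_prod_iff.1 hab
  have hseg := F.eventually_segmentSpeedLT he (segmentSpeedLT_self hy hε')
  rw [nhds_prod_eq] at hseg
  obtain ⟨q₁, hq₁, q₂, hq₂, hq⟩ := eventually_prod_iff.1 hseg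
  have hb' : ∀ᶠ b' in 𝓝 b, b' ∈ ball 0 1 ∧ p₂ b' ∧ q₂ (S.param b') :=
    (eventually_mem_set.2 (isOpen_ball.mem_nhds hb)).and
      (hp₂.and ((S.contMDiffAt hb).continuousAt.eventually hq₂))
  -- Height is a local homeomorphism on the section, so every plaque near `S.param b` meets `S` at
  -- an admissible parameter `b'`.
  have himg : (fun b => (e (S.param b)).2) '' {b' | b' ∈ ball 0 1 ∧ p₂ b' ∧ q₂ (S.param b')} ∈
      𝓝 (e (S.param b)).2 := by
    rw [← hL.map_nhds_eq_of_equiv]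
    exact image_mem_map hb'
  have hW : ∀ᶠ w in 𝓝 (S.param b), q₁ w ∧ (e w).2 ∈
      (fun b => (e (S.param b)).2) '' {b' | b' ∈ ball 0 1 ∧ p₂ b' ∧ q₂ (S.param b')} :=
    hq₁.and ((e.continuousAt hy).snd.eventually_mem himg)
  have hchain := (S.contMDiffAt ha).continuousAt.eventually (hch.eventually_exists hW)
  filter_upwards [hchain, hp₁, isOpen_ball.mem_nhds ha] with a' ⟨w, ⟨hw, b', ⟨hb1, hb2, hb3⟩, hb4⟩,
    hwc⟩ ha1 ha2
  exact ⟨ha2, b', hb1, (hp ha1 hb2).1, (hp ha1 hb2).2, _, hcε,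
    hwc.step ⟨e, he, hb4.symm, hq hw hb3⟩⟩

theorem isSplittable_of_leafVolume_horizontalBall_ne_top (F : AnalyticFoliation n d N)
    (hfin : ∀ (x : N) (l : ℝ), 0 < l → F.leafVolume (F.horizontalBall x l) ≠ ⊤) :
    F.IsSplittable := by
  intro xbar S l hl E hE hEpos
  -- `Related.plaqueChain` with `ε = 1` gives cost at most `4 * l + 1`; `returnSet` requires a
  -- strictly larger bound.
  have hC : 4 * ENNReal.ofReal l + 1 < ENNReal.ofReal (4 * l + 2) := by
    rw [show (4 : ℝ≥0∞) = ENNReal.ofReal 4 by simp, ← ENNReal.ofReal_mul (by simp),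
      ← ENNReal.ofReal_one, ← ENNReal.ofReal_add (by positivity) (by simp)]
    exact (ENNReal.ofReal_lt_ofReal_iff (by positivity)).2 (by linarith)
  set C := ENNReal.ofReal (4 * l + 2) with hCdef
  have hsplit : S.inDisc E ⊆ ⋃ k : ℕ, S.inDisc E \ S.returnSet C (1 / (k + 1)) := by
    intro a ha
    have := S.eventually_not_plaqueChain ha.1 (l := 4 * l + 2) (by positivity)
      (hfin _ _ (by positivity))
    obtain ⟨ε, hε, hball⟩ := Metric.eventually_nhds_iff.1 this
    obtain ⟨k, hk⟩ := exists_nat_one_div_lt hε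
    refine mem_iUnion.2 ⟨k, ha, ?_⟩
    rintro ⟨-, b, -, hba, hr, c, hc, hch⟩
    exact hball (hr.trans hk) hba ⟨c, hc.le, hch⟩
  obtain ⟨k, hk⟩ : ∃ k : ℕ, volume (S.inDisc E \ S.returnSet C (1 / (k + 1))) ≠ 0 := by
    by_contra! h
    exact hEpos.ne' (measure_mono_null hsplit (measure_iUnion_null h))
  -- A point near which the non-returning set has positive measure at every scale; radius `r / 2`
  -- then puts any two points of `D` at distance less than `r`.
  obtain ⟨a, -, ha⟩ := exists_mem_forall_mem_nhdsWithin_pos_measure hk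
  set r : ℝ := 1 / (k + 1) with hr
  have hrpos : 0 < r := by positivity
  set D := ball a (r / 2) ∩ (S.inDisc E \ S.returnSet C r) with hD
  have hDpos : 0 < volume D :=
    ha _ (inter_mem (mem_nhdsWithin_of_mem_nhds (ball_mem_nhds a (half_pos hrpos)))
      self_mem_nhdsWithin)
  have hDball : D ⊆ ball 0 1 := fun b hb => hb.2.1.1
  have hinj : InjOn S.param (ball 0 1) := fun u hu v hv h =>
    congrArg Subtype.val (S.isEmbedding.injective (a₁ := ⟨u, hu⟩) (a₂ := ⟨v, hv⟩) h)
  have hDisc : S.inDisc (S.param '' D) = D := by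
    refine Subset.antisymm ?_ fun b hb => ⟨hDball hb, mem_image_of_mem _ hb⟩
    rintro b ⟨hb, b', hb', h⟩
    rwa [← hinj (hDball hb') hb h]
  refine ⟨S.param '' D, ?_, ⟨?_, ?_⟩, ?_, ?_⟩
  · rintro _ ⟨b, hb, rfl⟩
    exact hb.2.1.2
  · exact image_mono hDball
  · rw [hDisc]
    exact isOpen_ball.measurableSet.nullMeasurableSet.inter
      (hE.2.diff (S.isOpen_returnSet C r).measurableSet.nullMeasurableSet)
  · rw [LocalTransverseSection.HasPositiveMeasure, hDisc]
    exact hDpos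
  · rintro _ ⟨b, hb, rfl⟩ _ ⟨b', hb', rfl⟩ hne hrel
    obtain ⟨c, hc, hch⟩ := hrel.plaqueChain one_pos
    refine hb.2.2 ⟨hDball hb, b', hDball hb', fun h => hne (by rw [h]), ?_, c, hc.trans_lt hC, hch⟩
    have h1 := dist_triangle_right b' b a
    have h2 := mem_ball.1 hb.1
    have h3 := mem_ball.1 hb'.1
    linarith

end

end AnalyticFoliation

end

theorem mainTheorem11 {n d : ℕ} (hd : 1 ≤ d) (hdn : d < n)
    {N : Type*} [TopologicalSpace N] [T2Space N]
    [ChartedSpace (EuclideanSpace ℝ (Fin n)) N] [IsManifold (𝓡 n) ω N]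
    [RiemannianBundle (fun x : N => TangentSpace (𝓡 n) x)]
    [IsContMDiffRiemannianBundle (𝓡 n) ∞ (EuclideanSpace ℝ (Fin n))
      (fun x : N => TangentSpace (𝓡 n) x)]
    (F : AnalyticFoliation n d N) (hF : F.HasLocallyFiniteVolumeBalls) :
    F.IsSplittable := by
  refine F.isSplittable_of_leafVolume_horizontalBall_ne_top fun x l hl => ?_
  obtain ⟨V, -, U, hU, h⟩ := hF x l hl
  exact ((h x (mem_of_mem_nhds hU)).trans_lt ENNReal.ofReal_lt_top).ne
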